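/- Let $D=\{x+iy\in\mathbb C:\ |x-\frac{\pi}{2}|+|y|<\frac{\pi}{2}\}$ be the open square with upper and lower vertices $z_0=\frac{\pi}{2}+i\frac{\pi}{2}$ and $z_1=\frac{\pi}{2}-i\frac{\pi}{2}$, let $\Delta=\{z\in\mathbb C\setminus\{0\}:\ |\arg z|<\frac{\pi}{4}\}$ (principal argument), and let $\pi-\Delta=\{\pi-z:\ z\in\Delta\}$, so that $D=\Delta\cap(\pi-\Delta)$. For an open set $\Omega\subset\mathbb C$ and a non-negative measurable weight $\omega$ on $\Omega$, let $A^2(\Omega,\omega)$ be the space of all holomorphic functions $f$ on $\Omega$ with $\int_\Omega |f(x+iy)|^2\,\omega(x+iy)\,dx\,dy<\infty$, and put $A^2(\Omega)=A^2(\Omega,1)$. Then $$A^2\left(D,\ |(z-z_0)(z-z_1)|^{-2}\right)\subset A^2(\Delta)+A^2(\pi-\Delta),$$ that is, for every $f\in A^2\left(D,|(z-z_0)(z-z_1)|^{-2}\right)$ there are $f_1\in A^2(\Delta)$ and $f_2\in A^2(\pi-\Delta)$ such that $f=f_1+f_2$ on $D$. -/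

import Mathlib

open MeasureTheory

/-- `f` restricted to `Ω` belongs to the weighted Bergman space `A^p(Ω, ω)`: it is holomorphic on
`Ω` and `∫_Ω |f|^p ω dx dy < ∞`. Only the values of `f` on `Ω` matter. -/
def weightedBergman (p : ℝ) (Ω : Set ℂ) (ω : ℂ → ℝ) : Set (ℂ → ℂ) :=
  {f | DifferentiableOn ℂ f Ω ∧
    ∫⁻ z in Ω, ENNReal.ofReal (‖f z‖ ^ p * ω z) ∂(volume : Measure ℂ) < ⊤}

/-- The classical Bergman space `A^p(Ω)`, with weight `1`. -/
def bergman (p : ℝ) (Ω : Set ℂ) : Set (ℂ → ℂ) :=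
  weightedBergman p Ω (fun _ => 1)

/-- The open sector `Δ = {|arg z| < π/4}`. The apex, where the argument is undefined, is
excluded explicitly because `Complex.arg 0 = 0`. -/
def sector : Set ℂ := {z | z ≠ 0 ∧ |Complex.arg z| < Real.pi / 4}

/-- The reflected sector `π - Δ`. -/
def reflectedSector : Set ℂ := {z | (Real.pi : ℂ) - z ∈ sector}

/-- The open square `D = {|x - π/2| + |y| < π/2}`. -/
def squareD : Set ℂ := {z | |z.re - Real.pi / 2| + |z.im| < Real.pi / 2}

/-- The upper vertex `π/2 + i π/2` of `D`. -/
noncomputable def vertexTop : ℂ := (Real.pi : ℂ) / 2 + Complex.I * ((Real.pi : ℂ) / 2)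

/-- The lower vertex `π/2 - i π/2` of `D`. -/
noncomputable def vertexBottom : ℂ := (Real.pi : ℂ) / 2 - Complex.I * ((Real.pi : ℂ) / 2)

/-!
The decomposition is obtained by solving a `∂̄`-equation with `L²` bounds. Let `χ` be a cut-off on `D`
which is `1` near the two left sides and `0` near the two right sides. Then `χ f`, extended by zero,
is smooth on `Δ`, while `(χ - 1) f`, extended by zero, is smooth on `π - Δ`, and the two have the same
`∂̄`-derivative `G = f ∂̄χ`. If `∂̄u = G`, then `f₁ = χ f - u` is holomorphic on `Δ`,
`f₂ = u - (χ - 1) f` is holomorphic on `π - Δ`, and `f₁ + f₂ = f` on `D`.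

The left and right sides meet at the vertices `z₀` and `z₁`, so the gradient of `χ` has to blow up
there; it can be kept `O(1 / (|z - z₀| |z - z₁|))` (`exists_norm_fderiv_cutoff_le`). The weight is
exactly what makes `G` square integrable.

For `u` one takes the Cauchy transform of `G` minus a simple pole off the closures of both sectors.
`∂̄u = G` holds on both sectors (`differentiableOn_sub_cauchyTransform`), by the Cauchy–Pompeiu
formula for compactly supported functions (`cauchyTransform_dbar`). Local square integrability of `u`
is Schur's test (`memLp_cauchyTransform_ball`). At infinity the Cauchy transform alone is only
`O(1 / |z|)`, which fails to be square integrable; the pole cancels the leading term and leaves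
`O(1 / |z|²)` (`norm_cauchyTransform_sub_le`).
-/

/-! ### The Cauchy–Riemann operator and the Cauchy transform -/

/-- The Cauchy–Riemann operator `∂F/∂z̄ = (∂F/∂x + i ∂F/∂y) / 2`. -/
noncomputable def dbar (F : ℂ → ℂ) (z : ℂ) : ℂ :=
  (fderiv ℝ F z 1 + Complex.I * fderiv ℝ F z Complex.I) / 2

/-- The Cauchy transform `(1/π) ∫ G(ζ) / (z - ζ) dA(ζ)`, normalised so that it inverts `dbar` on
compactly supported functions. -/
noncomputable def cauchyTransform (G : ℂ → ℂ) (z : ℂ) : ℂ :=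
  (Real.pi : ℂ)⁻¹ * ∫ ζ, G ζ / (z - ζ)

theorem dbar_congr {F₁ F₂ : ℂ → ℂ} {z : ℂ} (h : F₁ =ᶠ[nhds z] F₂) : dbar F₁ z = dbar F₂ z := by
  simp only [dbar, h.fderiv_eq]

theorem dbar_sub {F₁ F₂ : ℂ → ℂ} {z : ℂ} (h₁ : DifferentiableAt ℝ F₁ z)
    (h₂ : DifferentiableAt ℝ F₂ z) :
    dbar (fun w => F₁ w - F₂ w) z = dbar F₁ z - dbar F₂ z := by
  simp only [dbar, fderiv_fun_sub h₁ h₂, sub_apply]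
  ring

theorem dbar_eq_zero {f : ℂ → ℂ} {z : ℂ} (h : DifferentiableAt ℂ f z) : dbar f z = 0 := by
  have hI : fderiv ℂ f z Complex.I = Complex.I * fderiv ℂ f z 1 := by
    rw [← smul_eq_mul, ← map_smul, smul_eq_mul, mul_one]
  simp only [dbar, h.fderiv_restrictScalars ℝ, ContinuousLinearMap.coe_restrictScalars', hI]
  linear_combination (fderiv ℂ f z 1 / 2) * Complex.I_mul_I

theorem norm_dbar_ofReal_mul_le {χ : ℂ → ℝ} {f : ℂ → ℂ} {z : ℂ} (hχ : DifferentiableAt ℝ χ z)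
    (hf : DifferentiableAt ℂ f z) :
    ‖dbar (fun w => (χ w : ℂ) * f w) z‖ ≤ ‖fderiv ℝ χ z‖ * ‖f z‖ := by
  have hχ' : HasFDerivAt (fun w => (χ w : ℂ)) (Complex.ofRealCLM.comp (fderiv ℝ χ z)) z :=
    Complex.ofRealCLM.hasFDerivAt.comp z hχ.hasFDerivAt
  have hf' := (hf.restrictScalars ℝ).hasFDerivAt
  have h0 := dbar_eq_zero hf
  have : dbar (fun w => (χ w : ℂ) * f w) z
      = ((fderiv ℝ χ z 1 : ℂ) + Complex.I * (fderiv ℝ χ z Complex.I : ℂ)) / 2 * f z := by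
    rw [dbar] at h0 ⊢
    have hm : HasFDerivAt (fun w => (χ w : ℂ) * f w) _ z := hχ'.mul hf'
    rw [hm.fderiv]
    simp
    linear_combination (χ z : ℂ) * h0
  rw [this, norm_mul, norm_div]
  gcongr
  have h1 := (fderiv ℝ χ z).le_opNorm 1
  have h2 := (fderiv ℝ χ z).le_opNorm Complex.I
  have h3 := norm_add_le (fderiv ℝ χ z 1 : ℂ) (Complex.I * (fderiv ℝ χ z Complex.I : ℂ))
  simp only [norm_mul, Complex.norm_I, Complex.norm_real, norm_one, mul_one, one_mul] at h1 h2 h3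
  rw [show ‖(2 : ℂ)‖ = 2 by simp, div_le_iff₀ two_pos]
  linarith

theorem continuousAt_dbar {F : ℂ → ℂ} {z : ℂ} (hF : ContDiffAt ℝ 1 F z) :
    ContinuousAt (dbar F) z := by
  have := hF.continuousAt_fderiv one_ne_zero
  unfold dbar
  fun_prop

theorem HasCompactSupport.dbar {F : ℂ → ℂ} (hF : HasCompactSupport F) :
    HasCompactSupport (dbar F) := by
  refine (hF.fderiv (𝕜 := ℝ)).mono fun z hz h0 => hz ?_
  simp [_root_.dbar, h0]

theorem locallyIntegrable_inv : LocallyIntegrable (fun z : ℂ => z⁻¹) := by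
  refine locallyIntegrable_of_norm_le_rpow (α := 1) (C := 1) ?_ ?_ ?_ ?_
  · simp
  · simp
  · filter_upwards with z
    simp [Real.rpow_neg_one]
  · fun_prop

theorem integrable_div_sub {G : ℂ → ℂ} (hG : Continuous G) (hc : HasCompactSupport G) (z : ℂ) :
    Integrable fun ζ => G ζ / (z - ζ) := by
  have h1 : Integrable fun ζ => G (z - ζ) • ζ⁻¹ :=
    locallyIntegrable_inv.integrable_smul_left_of_hasCompactSupport (by fun_prop)
      (hc.comp_homeomorph (Homeomorph.subLeft z))
  simpa [div_eq_mul_inv] using h1.comp_sub_left z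

/-- The integrand of the polar-coordinate integrals, a directional derivative along the vector
`u(θ)` at the point `z + r e^{iθ}`, is integrable. -/
theorem integrableOn_polar_fderiv {ψ : ℂ → ℂ} (hψ : ContDiff ℝ 1 ψ) (hc : HasCompactSupport ψ)
    (z : ℂ) {u : ℝ → ℂ} (hu : Continuous u) :
    IntegrableOn (fun p : ℝ × ℝ =>
      fderiv ℝ ψ (z + p.1 * (Real.cos p.2 + Real.sin p.2 * Complex.I)) (u p.2))
      (Set.Ioi 0 ×ˢ Set.Ioo (-Real.pi) Real.pi) := by
  obtain ⟨R, hR⟩ := hc.isCompact.isBounded.subset_closedBall z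
  have hd := hψ.continuous_fderiv one_ne_zero
  have hcont : Continuous (fun p : ℝ × ℝ =>
      fderiv ℝ ψ (z + p.1 * (Real.cos p.2 + Real.sin p.2 * Complex.I)) (u p.2)) := by
    fun_prop
  refine IntegrableOn.of_forall_sdiff_eq_zero (s := Set.Icc 0 R ×ˢ Set.Icc (-Real.pi) Real.pi)
    (hcont.continuousOn.integrableOn_compact (isCompact_Icc.prod isCompact_Icc))
    (measurableSet_Ioi.prod measurableSet_Ioo) ?_
  rintro ⟨r, θ⟩ ⟨⟨hr, hθ⟩, hn⟩
  have hrR : R < r := by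
    by_contra h
    exact hn ⟨⟨le_of_lt hr, not_lt.1 h⟩, hθ.1.le, hθ.2.le⟩
  have hout : z + r * (Real.cos θ + Real.sin θ * Complex.I) ∉ tsupport ψ := by
    intro h
    have := hR h
    rw [mem_closedBall_iff_norm, add_sub_cancel_left, norm_mul, Complex.ofReal_cos,
      Complex.ofReal_sin, Complex.norm_cos_add_sin_mul_I, Complex.norm_real, mul_one,
      Real.norm_of_nonneg (le_of_lt hr)] at this
    linarith
  simp only
  rw [fderiv_of_notMem_tsupport (𝕜 := ℝ) hout]
  simp

/-- **Cauchy–Pompeiu formula** for compactly supported functions. In polar coordinates around `z`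
the integrand splits into a radial derivative, which integrates to `-ψ z` along each ray, and an
angular derivative, which integrates to zero along each circle. -/
theorem cauchyTransform_dbar {ψ : ℂ → ℂ} (hψ : ContDiff ℝ 1 ψ) (hc : HasCompactSupport ψ)
    (z : ℂ) : cauchyTransform (dbar ψ) z = ψ z := by
  set e : ℝ → ℂ := fun θ => Real.cos θ + Real.sin θ * Complex.I with he
  have hecont : Continuous e := by fun_prop
  have hden : ∀ θ, e θ ≠ 0 := fun θ h => by
    have := Complex.norm_cos_add_sin_mul_I θ
    simp only [he, Complex.ofReal_cos, Complex.ofReal_sin] at h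
    simp [h] at this
  have hdiff : ∀ w, HasFDerivAt ψ (fderiv ℝ ψ w) w := fun w =>
    (hψ.differentiable one_ne_zero w).hasFDerivAt
  have hed : ∀ θ, HasDerivAt e (Complex.I * e θ) θ := fun θ => by
    have h1 := (Real.hasDerivAt_cos θ).ofReal_comp
    have h2 := ((Real.hasDerivAt_sin θ).ofReal_comp).mul_const Complex.I
    refine (h1.add h2).congr_deriv ?_
    simp only [he]
    push_cast
    linear_combination (-Complex.sin θ) * Complex.I_mul_I
  set A : ℝ × ℝ → ℂ := fun p => fderiv ℝ ψ (z + p.1 * e p.2) (e p.2) with hA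
  set B : ℝ × ℝ → ℂ := fun p => fderiv ℝ ψ (z + p.1 * e p.2) (Complex.I * e p.2) with hB
  set S : Set (ℝ × ℝ) := Set.Ioi 0 ×ˢ Set.Ioo (-Real.pi) Real.pi with hS
  have hAi : IntegrableOn A S := integrableOn_polar_fderiv hψ hc z hecont
  have hBi : IntegrableOn B S := integrableOn_polar_fderiv hψ hc z (hecont.const_mul _)
  have hpol : ∫ ζ, dbar ψ ζ / (z - ζ) = ∫ p in S, -(1 / 2 : ℂ) * (A p + Complex.I * B p) := by
    rw [← integral_add_left_eq_self _ z, ← Complex.integral_comp_polarCoord_symm]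
    refine setIntegral_congr_fun (measurableSet_Ioi.prod measurableSet_Ioo) ?_
    rintro ⟨r, θ⟩ ⟨hr, -⟩
    have hr' : (r : ℂ) ≠ 0 := by exact_mod_cast (ne_of_gt hr)
    have hlin : ∀ v : ℂ, fderiv ℝ ψ (z + r * e θ) v
        = v.re * fderiv ℝ ψ (z + r * e θ) 1 + v.im * fderiv ℝ ψ (z + r * e θ) Complex.I := by
      intro v
      conv_lhs => rw [show v = v.re • (1 : ℂ) + v.im • Complex.I by
        simp [Complex.re_add_im]]
      rw [map_add, map_smul, map_smul, Complex.real_smul, Complex.real_smul]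
    have hconj : (Real.cos θ - Real.sin θ * Complex.I) * e θ = 1 := by
      have := Complex.sin_sq_add_cos_sq θ
      simp only [he]
      push_cast
      linear_combination this - Complex.sin θ ^ 2 * Complex.I_mul_I
    simp only [Complex.polarCoord_symm_apply, hA, hB]
    change r • (dbar ψ (z + r * e θ) / (z - (z + r * e θ))) = _
    rw [hlin (e θ), hlin (Complex.I * e θ), dbar, Complex.real_smul]
    have hre : (e θ).re = Real.cos θ := by simp [he, -Complex.ofReal_cos, -Complex.ofReal_sin]
    have him : (e θ).im = Real.sin θ := by simp [he, -Complex.ofReal_cos, -Complex.ofReal_sin]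
    rw [Complex.I_mul_re, Complex.I_mul_im, hre, him]
    have h2 := hden θ
    generalize fderiv ℝ ψ (z + r * e θ) 1 = a at *
    generalize fderiv ℝ ψ (z + r * e θ) Complex.I = b at *
    have : z - (z + r * e θ) = -(r * e θ) := by ring
    rw [this, Complex.ofReal_neg]
    field_simp
    have hI : Complex.I ^ 2 = -1 := Complex.I_sq
    have key : (Real.cos θ : ℂ) * a + Real.sin θ * b
        + Complex.I * (-Real.sin θ * a + Real.cos θ * b)
        = (Real.cos θ - Real.sin θ * Complex.I) * (a + Complex.I * b) := by
      linear_combination (Real.sin θ * b : ℂ) * hI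
    have : (a + Complex.I * b) = e θ * ((Real.cos θ : ℂ) * a + Real.sin θ * b
        + Complex.I * (-Real.sin θ * a + Real.cos θ * b)) := by
      rw [key]
      linear_combination (-(a + Complex.I * b)) * hconj
    linear_combination -this
  have hAint : ∫ p in S, A p = -(2 * Real.pi) * ψ z := by
    have hray : ∀ θ, ∫ r in Set.Ioi (0 : ℝ), A (r, θ) = -ψ z := by
      intro θ
      have hline : ∀ r : ℝ, HasDerivAt (fun r : ℝ => z + r * e θ) (e θ) r := fun r => by
        simpa using (((hasDerivAt_id r).ofReal_comp).mul_const (e θ)).const_add z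
      have hemb : Topology.IsClosedEmbedding fun r : ℝ => z + (r : ℂ) * e θ := by
        exact ((Homeomorph.addLeft z).isClosedEmbedding.comp
          (Homeomorph.mulRight₀ (e θ) (hden θ)).isClosedEmbedding).comp
          Complex.isometry_ofReal.isClosedEmbedding
      have hcd : ContDiff ℝ 1 fun r : ℝ => ψ (z + r * e θ) := by
        refine hψ.comp ?_
        exact contDiff_const.add (Complex.ofRealCLM.contDiff.mul contDiff_const)
      have := (hc.comp_isClosedEmbedding hemb).integral_Ioi_deriv_eq hcd 0
      simp only [Complex.ofReal_zero, zero_mul, add_zero] at this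
      rw [← this]
      refine integral_congr_ae (Filter.Eventually.of_forall fun r => ?_)
      exact (((hdiff _).comp_hasDerivAt r (hline r)).deriv).symm
    have hsw : IntegrableOn (fun p : ℝ × ℝ => A p.swap)
        (Set.Ioo (-Real.pi) Real.pi ×ˢ Set.Ioi 0) := by
      exact hAi.swap
    have := setIntegral_prod_swap (μ := volume) (ν := volume) (Set.Ioi (0 : ℝ))
      (Set.Ioo (-Real.pi) Real.pi) A
    rw [hS]
    refine this.symm.trans ?_
    refine (setIntegral_prod (μ := volume) (ν := volume) _ hsw).trans ?_
    simp only [Prod.swap_prod_mk, hray]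
    rw [setIntegral_const]
    simp only [Measure.real, Real.volume_Ioo, Complex.real_smul]
    rw [ENNReal.toReal_ofReal (by linarith [Real.pi_pos])]
    push_cast
    ring
  have hBint : ∫ p in S, B p = 0 := by
    refine (setIntegral_prod (μ := volume) (ν := volume) _ hBi).trans ?_
    refine setIntegral_eq_zero_of_forall_eq_zero fun r hr => ?_
    have hr' : (r : ℂ) ≠ 0 := by exact_mod_cast (ne_of_gt hr)
    have hcirc : ∀ θ : ℝ, HasDerivAt (fun θ => (r : ℂ)⁻¹ * ψ (z + r * e θ)) (B (r, θ)) θ := by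
      intro θ
      have h1 : HasDerivAt (fun θ => z + r * e θ) (r • (Complex.I * e θ)) θ := by
        simpa using ((hed θ).const_mul (r : ℂ)).const_add z
      have h2 := ((hdiff (z + r * e θ)).comp_hasDerivAt θ h1).const_mul (r : ℂ)⁻¹
      refine h2.congr_deriv ?_
      rw [map_smul, Complex.real_smul, inv_mul_cancel_left₀ hr']
    have hBc : Continuous fun θ => B (r, θ) := by
      have hd := hψ.continuous_fderiv one_ne_zero
      simp only [hB]
      fun_prop
    rw [← integral_Ioc_eq_integral_Ioo,
      ← intervalIntegral.integral_of_le (by linarith [Real.pi_pos]),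
      intervalIntegral.integral_eq_sub_of_hasDerivAt (fun θ _ => hcirc θ)
        (hBc.intervalIntegrable _ _)]
    simp [he]
  rw [cauchyTransform, hpol, integral_const_mul,
    integral_add hAi (hBi.const_mul _), integral_const_mul, hAint, hBint]
  have : (Real.pi : ℂ) ≠ 0 := by exact_mod_cast Real.pi_ne_zero
  field_simp
  ring

/-- The Cauchy transform is holomorphic off the support of its density. -/
theorem differentiableAt_cauchyTransform {G : ℂ → ℂ} {z₀ : ℂ} (hG : Integrable G)
    (h0 : ∀ᶠ ζ in nhds z₀, G ζ = 0) : DifferentiableAt ℂ (cauchyTransform G) z₀ := by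
  obtain ⟨δ, hδ, hball⟩ := Metric.eventually_nhds_iff_ball.1 h0
  have hfar : ∀ z ∈ Metric.ball z₀ (δ / 2), ∀ ζ, G ζ ≠ 0 → δ / 2 ≤ ‖z - ζ‖ := by
    intro z hz ζ hζ
    by_contra! h
    refine hζ (hball ζ ?_)
    rw [Metric.mem_ball] at hz ⊢
    have h1 := dist_triangle ζ z z₀
    rw [← dist_eq_norm, dist_comm] at h
    linarith
  have hbd : ∀ z ∈ Metric.ball z₀ (δ / 2), ∀ ζ, ‖G ζ / (z - ζ)‖ ≤ (2 / δ) * ‖G ζ‖ := by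
    intro z hz ζ
    by_cases hζ : G ζ = 0
    · simp [hζ]
    have := hfar z hz ζ hζ
    rw [norm_div, div_le_iff₀ (by linarith)]
    have h2 : 1 ≤ 2 / δ * ‖z - ζ‖ := by
      calc (1 : ℝ) = 2 / δ * (δ / 2) := by field_simp
        _ ≤ _ := by gcongr
    nlinarith [norm_nonneg (G ζ)]
  have hmeas : ∀ z, AEStronglyMeasurable (fun ζ => G ζ / (z - ζ)) := fun z =>
    (hG.aestronglyMeasurable.aemeasurable.div (by fun_prop)).aestronglyMeasurable
  refine ((hasDerivAt_integral_of_dominated_loc_of_deriv_le (μ := volume) (𝕜 := ℂ)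
    (F := fun z ζ => G ζ / (z - ζ)) (F' := fun z ζ => - G ζ / (z - ζ) ^ 2)
    (bound := fun ζ => (2 / δ) ^ 2 * ‖G ζ‖)
    (Metric.ball_mem_nhds z₀ (half_pos hδ)) ?_ ?_ ?_ ?_ ?_ ?_).2.differentiableAt).const_mul _
  · exact Filter.Eventually.of_forall hmeas
  · exact (hG.norm.const_mul (2 / δ)).mono' (hmeas z₀)
      (Filter.Eventually.of_forall (hbd z₀ (Metric.mem_ball_self (half_pos hδ))))
  · exact (hG.aestronglyMeasurable.aemeasurable.neg.div (by fun_prop)).aestronglyMeasurable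
  · refine Filter.Eventually.of_forall fun ζ z hz => ?_
    by_cases hζ : G ζ = 0
    · simp [hζ]
    have := hfar z hz ζ hζ
    have hpos : 0 < ‖z - ζ‖ := by linarith
    rw [norm_div, norm_neg, norm_pow, div_le_iff₀ (by positivity)]
    have h2 : 1 ≤ 2 / δ * ‖z - ζ‖ := by
      calc (1 : ℝ) = 2 / δ * (δ / 2) := by field_simp
        _ ≤ _ := by gcongr
    have h3 : 1 ≤ (2 / δ * ‖z - ζ‖) ^ 2 := one_le_pow₀ h2
    nlinarith [norm_nonneg (G ζ)]
  · exact hG.norm.const_mul _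
  · refine Filter.Eventually.of_forall fun ζ z hz => ?_
    by_cases hζ : G ζ = 0
    · simpa [hζ] using hasDerivAt_const z (0 : ℂ)
    have := hfar z hz ζ hζ
    have hne : z - ζ ≠ 0 := fun h => by rw [h, norm_zero] at this; linarith
    have := ((hasDerivAt_id z).sub_const ζ).inv hne
    simpa [div_eq_mul_inv, neg_mul, mul_neg] using this.const_mul (G ζ)

/-- The Cauchy transform solves the `∂̄`-equation: if `∂̄F = G` on the open set `Ω`, then
`F - cauchyTransform G` is holomorphic there. Near a given point, subtracting from `G` the `∂̄` of a
cut-off of `F` leaves a density that vanishes near that point. -/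
theorem differentiableOn_sub_cauchyTransform {Ω : Set ℂ} (hΩ : IsOpen Ω) {F G : ℂ → ℂ}
    (hF : ContDiffOn ℝ 1 F Ω) (hG : Integrable G) (hFG : ∀ z ∈ Ω, dbar F z = G z) :
    DifferentiableOn ℂ (fun z => F z - cauchyTransform G z) Ω := by
  intro z₀ hz₀
  refine DifferentiableAt.differentiableWithinAt ?_
  obtain ⟨r, hr, hrΩ⟩ := Metric.isOpen_iff.1 hΩ z₀ hz₀
  let φ : ContDiffBump z₀ := ⟨r / 4, r / 2, by linarith, by linarith⟩
  set ψ : ℂ → ℂ := fun z => (φ z : ℂ) * F z with hψdef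
  have hsupp : tsupport φ ⊆ Ω := by
    rw [φ.tsupport_eq]
    exact (Metric.closedBall_subset_ball (by simp only [φ]; linarith)).trans hrΩ
  have hψs : tsupport ψ ⊆ tsupport φ := closure_mono fun z hz h => hz (by
    simp [hψdef, h])
  have hψc : HasCompactSupport ψ :=
    φ.hasCompactSupport.of_isClosed_subset (isClosed_tsupport ψ) hψs
  have hψ : ContDiff ℝ 1 ψ := by
    rw [contDiff_iff_contDiffAt]
    intro z
    by_cases hz : z ∈ tsupport φ
    · exact (Complex.ofRealCLM.contDiff.contDiffAt.comp z φ.contDiffAt).mul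
        (hF.contDiffAt (hΩ.mem_nhds (hsupp hz)))
    · have : ψ =ᶠ[nhds z] fun _ => 0 := notMem_tsupport_iff_eventuallyEq.1 fun h => hz (hψs h)
      exact contDiffAt_const.congr_of_eventuallyEq this
  have hnear : ∀ᶠ z in nhds z₀, ψ z = F z ∧ dbar ψ z = G z := by
    have h1 : ∀ᶠ z in nhds z₀, ψ z = F z := by
      filter_upwards [φ.eventuallyEq_one] with z hz
      simp [hψdef, hz]
    filter_upwards [h1.eventually_nhds, hΩ.mem_nhds hz₀] with z hz hzΩ
    exact ⟨hz.self_of_nhds, (dbar_congr hz).trans (hFG z hzΩ)⟩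
  have hdψ : Continuous (dbar ψ) :=
    continuous_iff_continuousAt.2 fun z => continuousAt_dbar hψ.contDiffAt
  have hdi : Integrable (dbar ψ) := hdψ.integrable_of_hasCompactSupport hψc.dbar
  set H : ℂ → ℂ := fun ζ => G ζ - dbar ψ ζ with hH
  have hHi : Integrable H := hG.sub hdi
  have hH0 : ∀ᶠ ζ in nhds z₀, H ζ = 0 := hnear.mono fun ζ hζ => by simp [hH, hζ.2]
  have heq : (fun z => F z - cauchyTransform G z) =ᶠ[nhds z₀] fun z => -cauchyTransform H z := by
    filter_upwards [hnear, hH0.eventually_nhds] with z hz hHz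
    have hi2 := integrable_div_sub hdψ hψc.dbar z
    have hi1 : Integrable fun ζ => H ζ / (z - ζ) := by
      obtain ⟨δ, hδ, hball⟩ := Metric.eventually_nhds_iff_ball.1 hHz
      refine (hHi.norm.const_mul δ⁻¹).mono'
        (hHi.aestronglyMeasurable.aemeasurable.div (by fun_prop)).aestronglyMeasurable
        (Filter.Eventually.of_forall fun ζ => ?_)
      by_cases hζ : H ζ = 0
      · simp [hζ]
      have hfar : δ ≤ ‖z - ζ‖ := by
        by_contra! h
        exact hζ (hball ζ (by rwa [Metric.mem_ball, dist_comm, dist_eq_norm]))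
      rw [norm_div, div_eq_inv_mul]
      gcongr
    have hsplit : cauchyTransform G z = cauchyTransform H z + cauchyTransform (dbar ψ) z := by
      simp only [cauchyTransform]
      rw [← mul_add, ← integral_add hi1 hi2]
      congr 1
      refine integral_congr_ae (Filter.Eventually.of_forall fun ζ => ?_)
      simp only [hH]
      ring
    rw [hsplit, cauchyTransform_dbar hψ hψc, hz.1]
    ring
  exact (differentiableAt_cauchyTransform hHi hH0).neg.congr_of_eventuallyEq heq

/-! ### Square integrability of Cauchy transforms -/

theorem lintegral_enorm_inv_ball_lt_top (R : ℝ) :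
    ∫⁻ w in Metric.ball (0 : ℂ) R, ‖w⁻¹‖ₑ < ⊤ :=
  ((locallyIntegrable_inv.integrableOn_isCompact (isCompact_closedBall 0 R)).mono_set
    Metric.ball_subset_closedBall).2

theorem setLIntegral_enorm_inv_sub_le {ρ R : ℝ} {z : ℂ} (hz : z ∈ Metric.ball (0 : ℂ) R) :
    ∫⁻ ζ in Metric.ball (0 : ℂ) ρ, ‖(z - ζ)⁻¹‖ₑ
      ≤ ∫⁻ w in Metric.ball (0 : ℂ) (R + ρ), ‖w⁻¹‖ₑ := by
  rw [← lintegral_indicator Metric.isOpen_ball.measurableSet,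
    ← lintegral_indicator Metric.isOpen_ball.measurableSet,
    ← lintegral_sub_left_eq_self (Set.indicator _ fun w : ℂ => ‖w⁻¹‖ₑ) z]
  refine lintegral_mono fun ζ => ?_
  by_cases hζ : ζ ∈ Metric.ball (0 : ℂ) ρ
  · have : z - ζ ∈ Metric.ball (0 : ℂ) (R + ρ) := by
      rw [mem_ball_zero_iff] at *
      exact (norm_sub_le z ζ).trans_lt (add_lt_add hz hζ)
    rw [Set.indicator_of_mem hζ, Set.indicator_of_mem this]
  · simp [Set.indicator_of_notMem hζ]

/-- Weighted Cauchy–Schwarz inequality `(∫ a k)² ≤ (∫ a² k) (∫ k)`. -/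
theorem sq_lintegral_mul_le {α : Type*} [MeasurableSpace α] {μ : Measure α} {a k : α → ENNReal}
    (ha : AEMeasurable a μ) (hk : AEMeasurable k μ) :
    (∫⁻ x, a x * k x ∂μ) ^ 2 ≤ (∫⁻ x, a x ^ 2 * k x ∂μ) * ∫⁻ x, k x ∂μ := by
  have hs : ∀ t : ENNReal, t ^ (1 / 2 : ℝ) * t ^ (1 / 2 : ℝ) = t := fun t => by
    rw [← ENNReal.rpow_add_of_nonneg _ _ (by norm_num) (by norm_num)]
    norm_num
  have h := ENNReal.lintegral_mul_le_Lp_mul_Lq μ Real.HolderConjugate.two_two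
    (ha.mul (hk.pow_const (1 / 2 : ℝ))) (hk.pow_const (1 / 2 : ℝ))
  have hak : ∀ x, (a x * k x ^ (1 / 2 : ℝ)) * (a x * k x ^ (1 / 2 : ℝ)) = a x * a x * k x :=
    fun x => by rw [mul_mul_mul_comm, hs]
  simp only [Pi.mul_apply, ENNReal.rpow_two, sq, hak, mul_assoc (a _) (k _ ^ (1 / 2 : ℝ)), hs] at h
  calc (∫⁻ x, a x * k x ∂μ) ^ 2 ≤ _ := pow_le_pow_left' h 2
    _ = _ := by
      rw [sq, mul_mul_mul_comm, hs, hs]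
      simp only [sq]

/-- The Cauchy transform of a compactly supported square integrable density is locally square
integrable: this is Schur's test for the locally integrable kernel `1 / (z - ζ)`. -/
theorem memLp_cauchyTransform_ball {G : ℂ → ℂ} {ρ : ℝ} (hG : Measurable G) (hG2 : MemLp G 2)
    (hsupp : ∀ ζ ∉ Metric.ball (0 : ℂ) ρ, G ζ = 0) (R : ℝ) :
    MemLp (cauchyTransform G) 2 (volume.restrict (Metric.ball 0 R)) := by
  refine MemLp.const_mul ?_ _
  have hm : Measurable fun p : ℂ × ℂ => G p.2 / (p.1 - p.2) := by fun_prop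
  refine ⟨hm.stronglyMeasurable.integral_prod_right'.aestronglyMeasurable, ?_⟩
  rw [eLpNorm_lt_top_iff_lintegral_rpow_enorm_lt_top (by simp) (by simp)]
  simp only [ENNReal.toReal_ofNat, ENNReal.rpow_two]
  have hGfin : ∫⁻ ζ, ‖G ζ‖ₑ ^ 2 < ⊤ := by
    have := (eLpNorm_lt_top_iff_lintegral_rpow_enorm_lt_top (by simp) (by simp)).1 hG2.2
    simpa using this
  set M := ∫⁻ w in Metric.ball (0 : ℂ) (R + ρ), ‖w⁻¹‖ₑ with hM
  have hMfin : M < ⊤ := lintegral_enorm_inv_ball_lt_top _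
  set B := Metric.ball (0 : ℂ) ρ with hB
  have hpt : ∀ z ∈ Metric.ball (0 : ℂ) R, ‖∫ ζ, G ζ / (z - ζ)‖ₑ ^ 2
      ≤ (∫⁻ ζ in B, ‖G ζ‖ₑ ^ 2 * ‖(z - ζ)⁻¹‖ₑ) * M := by
    intro z hz
    have h1 : ‖∫ ζ, G ζ / (z - ζ)‖ₑ ≤ ∫⁻ ζ in B, ‖G ζ‖ₑ * ‖(z - ζ)⁻¹‖ₑ := by
      rw [← setIntegral_eq_integral_of_forall_compl_eq_zero (s := B)
        (fun ζ hζ => by rw [hsupp ζ hζ, zero_div])]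
      refine (enorm_integral_le_lintegral_enorm _).trans_eq ?_
      simp only [div_eq_mul_inv, enorm_mul]
    calc _ ≤ (∫⁻ ζ in B, ‖G ζ‖ₑ * ‖(z - ζ)⁻¹‖ₑ) ^ 2 := pow_le_pow_left' h1 2
      _ ≤ _ := sq_lintegral_mul_le (by fun_prop) (by fun_prop)
      _ ≤ _ := mul_le_mul_right (setLIntegral_enorm_inv_sub_le hz) _
  calc ∫⁻ z in Metric.ball (0 : ℂ) R, ‖∫ ζ, G ζ / (z - ζ)‖ₑ ^ 2
      ≤ ∫⁻ z in Metric.ball (0 : ℂ) R, (∫⁻ ζ in B, ‖G ζ‖ₑ ^ 2 * ‖(z - ζ)⁻¹‖ₑ) * M :=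
        setLIntegral_mono' Metric.isOpen_ball.measurableSet hpt
    _ = (∫⁻ z in Metric.ball (0 : ℂ) R, ∫⁻ ζ in B, ‖G ζ‖ₑ ^ 2 * ‖(z - ζ)⁻¹‖ₑ) * M :=
        lintegral_mul_const' _ _ hMfin.ne
    _ = (∫⁻ ζ in B, ∫⁻ z in Metric.ball (0 : ℂ) R, ‖G ζ‖ₑ ^ 2 * ‖(z - ζ)⁻¹‖ₑ) * M := by
        rw [lintegral_lintegral_swap]
        fun_prop
    _ ≤ (∫⁻ ζ in B, ‖G ζ‖ₑ ^ 2 * M) * M := by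
        refine mul_le_mul_left (setLIntegral_mono' Metric.isOpen_ball.measurableSet
          fun ζ hζ => ?_) _
        rw [lintegral_const_mul' _ _ (by simp)]
        refine mul_le_mul_right ?_ _
        have := setLIntegral_enorm_inv_sub_le (ρ := R) hζ
        rw [add_comm] at this
        refine le_trans (le_of_eq ?_) this
        refine lintegral_congr fun z => ?_
        rw [← neg_sub, inv_neg, enorm_neg]
    _ < ⊤ := by
        rw [lintegral_mul_const' _ _ hMfin.ne]
        exact ENNReal.mul_lt_top (ENNReal.mul_lt_top
          ((setLIntegral_le_lintegral _ _).trans_lt hGfin) hMfin) hMfin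

/-- A Cauchy transform decays only like `1 / |z|`, which is not square integrable at infinity; once
its leading term is removed by a simple pole at `w₀`, it decays like `1 / |z|²`. -/
theorem norm_cauchyTransform_sub_le {G : ℂ → ℂ} {ρ : ℝ} {w₀ z : ℂ} (hG : Integrable G)
    (hρ : 0 < ρ) (hsupp : ∀ ζ ∉ Metric.ball (0 : ℂ) ρ, G ζ = 0) (hw : ‖w₀‖ ≤ ρ)
    (hz : 2 * ρ ≤ ‖z‖) :
    ‖cauchyTransform G z - (Real.pi : ℂ)⁻¹ * (∫ ζ, G ζ) / (z - w₀)‖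
      ≤ (Real.pi⁻¹ * (8 * ρ * ∫ ζ, ‖G ζ‖)) * (‖z‖ ^ 2)⁻¹ := by
  have hfar : ∀ ζ : ℂ, ‖ζ‖ ≤ ρ → ‖z‖ / 2 ≤ ‖z - ζ‖ := fun ζ hζ => by
    have := norm_sub_norm_le z ζ
    linarith
  have hz0 : 0 < ‖z‖ := by linarith
  have hmeas : AEStronglyMeasurable fun ζ => G ζ / (z - ζ) :=
    (hG.aestronglyMeasurable.aemeasurable.div (by fun_prop)).aestronglyMeasurable
  have hi1 : Integrable fun ζ => G ζ / (z - ζ) := by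
    refine (hG.norm.const_mul (‖z‖ / 2)⁻¹).mono' hmeas (Filter.Eventually.of_forall fun ζ => ?_)
    by_cases hζ : ζ ∈ Metric.ball (0 : ℂ) ρ
    · rw [norm_div, div_eq_inv_mul]
      have := hfar ζ (mem_ball_zero_iff.1 hζ).le
      gcongr
    · simp [hsupp ζ hζ]
  have heq : cauchyTransform G z - (Real.pi : ℂ)⁻¹ * (∫ ζ, G ζ) / (z - w₀)
      = (Real.pi : ℂ)⁻¹ * ∫ ζ, (G ζ / (z - ζ) - G ζ / (z - w₀)) := by
    rw [integral_sub hi1 (hG.div_const _), integral_div, cauchyTransform]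
    ring
  rw [heq, norm_mul, norm_inv, Complex.norm_real, Real.norm_of_nonneg Real.pi_pos.le,
    mul_assoc]
  refine mul_le_mul_of_nonneg_left ?_ (by positivity)
  calc _ ≤ ∫ ζ, 8 * ρ * (‖z‖ ^ 2)⁻¹ * ‖G ζ‖ := by
        refine norm_integral_le_of_norm_le (hG.norm.const_mul _)
          (Filter.Eventually.of_forall fun ζ => ?_)
        by_cases hζ : ζ ∈ Metric.ball (0 : ℂ) ρ
        · have hζ' := (mem_ball_zero_iff.1 hζ).le
          have h1 := hfar ζ hζ'
          have h2 := hfar w₀ hw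
          have n1 : z - ζ ≠ 0 := norm_pos_iff.1 (by linarith)
          have n2 : z - w₀ ≠ 0 := norm_pos_iff.1 (by linarith)
          have : G ζ / (z - ζ) - G ζ / (z - w₀)
              = (ζ - w₀) * G ζ / ((z - ζ) * (z - w₀)) := by
            field_simp
            ring
          rw [this, norm_div, norm_mul, norm_mul, div_le_iff₀ (by positivity)]
          have h3 : ‖ζ - w₀‖ ≤ 2 * ρ := (norm_sub_le _ _).trans (by linarith)
          have h4 : (‖z‖ / 2) * (‖z‖ / 2) ≤ ‖z - ζ‖ * ‖z - w₀‖ := by gcongr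
          calc ‖ζ - w₀‖ * ‖G ζ‖ ≤ 2 * ρ * ‖G ζ‖ := by gcongr
            _ = 8 * ρ * (‖z‖ ^ 2)⁻¹ * ‖G ζ‖ * ((‖z‖ / 2) * (‖z‖ / 2)) := by
              field_simp
              ring
            _ ≤ _ := by gcongr
        · simp [hsupp ζ hζ]
    _ = _ := by
        rw [integral_const_mul]
        ring

theorem memLp_two_inv_sq_norm_compl_ball {R : ℝ} (hR : 1 ≤ R) :
    MemLp (fun z : ℂ => (‖z‖ ^ 2)⁻¹) 2 (volume.restrict (Metric.ball 0 R)ᶜ) := by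
  have hm : Measurable fun z : ℂ => (‖z‖ ^ 2)⁻¹ := by fun_prop
  rw [memLp_two_iff_integrable_sq hm.aestronglyMeasurable]
  have h := (integrable_one_add_norm (E := ℂ) (μ := volume) (r := 4) (by norm_num)).const_mul 16
  refine (h.mono_measure Measure.restrict_le_self).mono' (hm.pow_const 2).aestronglyMeasurable ?_
  filter_upwards [ae_restrict_mem Metric.isOpen_ball.measurableSet.compl] with z hz
  have hz1 : 1 ≤ ‖z‖ := by
    rw [Set.mem_compl_iff, mem_ball_zero_iff, not_lt] at hz
    linarith
  have : (1 + ‖z‖) ^ (-4 : ℝ) = ((1 + ‖z‖) ^ 4)⁻¹ := by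
    rw [Real.rpow_neg (by positivity)]
    norm_cast
  rw [this, Real.norm_of_nonneg (by positivity), ← inv_pow, ← pow_mul]
  have h2 : (1 + ‖z‖) ^ 4 ≤ (2 * ‖z‖) ^ 4 := by gcongr; linarith
  rw [inv_pow, inv_le_iff_one_le_mul₀ (by positivity)]
  calc (1 : ℝ) = 16 * ((2 * ‖z‖) ^ 4)⁻¹ * ‖z‖ ^ (2 * 2) := by
        field_simp
        norm_num
    _ ≤ _ := by gcongr

theorem mem_bergman_two_iff {Ω : Set ℂ} (hΩ : IsOpen Ω) {f : ℂ → ℂ} :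
    f ∈ bergman 2 Ω ↔ DifferentiableOn ℂ f Ω ∧ MemLp f 2 (volume.restrict Ω) := by
  refine and_congr_right fun hf => ?_
  have hm : AEStronglyMeasurable f (volume.restrict Ω) :=
    hf.continuousOn.aestronglyMeasurable hΩ.measurableSet
  rw [MemLp, and_iff_right hm, eLpNorm_lt_top_iff_lintegral_rpow_enorm_lt_top (by simp) (by simp)]
  have : ∀ z, ENNReal.ofReal (‖f z‖ ^ (2 : ℝ) * 1) = ‖f z‖ₑ ^ (2 : ENNReal).toReal := fun z => by
    rw [mul_one, ← ENNReal.ofReal_rpow_of_nonneg (norm_nonneg _) (by norm_num),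
      ofReal_norm, ENNReal.toReal_ofNat]
  simp only [this]

theorem MeasureTheory.MemLp.restrict_of_inter_of_diff {f : ℂ → ℂ} {s B : Set ℂ}
    (hB : MeasurableSet B) (hf : AEStronglyMeasurable f (volume.restrict s))
    (h₁ : MemLp f 2 (volume.restrict (s ∩ B))) (h₂ : MemLp f 2 (volume.restrict (s \ B))) :
    MemLp f 2 (volume.restrict s) := by
  refine ⟨hf, ?_⟩
  have e₁ := (eLpNorm_lt_top_iff_lintegral_rpow_enorm_lt_top (by simp) (by simp)).1 h₁.2
  have e₂ := (eLpNorm_lt_top_iff_lintegral_rpow_enorm_lt_top (by simp) (by simp)).1 h₂.2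
  rw [eLpNorm_lt_top_iff_lintegral_rpow_enorm_lt_top (by simp) (by simp),
    ← lintegral_inter_add_sdiff _ s hB]
  exact ENNReal.add_lt_top.2 ⟨e₁, e₂⟩

/-- Correction of a smooth function `F`, supported in a disc, to an element of the Bergman space
`A²(Ω)`, by means of a solution of `∂̄u = ∂̄F` which depends only on the density `G = ∂̄F` and not on
`Ω`. The pole `w₀` of the correction has to lie off the closure of `Ω`. -/
theorem sub_cauchyTransform_mem_bergman {Ω : Set ℂ} (hΩ : IsOpen Ω) {F G : ℂ → ℂ} {ρ ε : ℝ}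
    {w₀ : ℂ} (hρ : 1 ≤ ρ) (hF : ContDiffOn ℝ 1 F Ω) (hF2 : MemLp F 2 (volume.restrict Ω))
    (hFsupp : ∀ ζ ∉ Metric.ball (0 : ℂ) ρ, F ζ = 0)
    (hG : Measurable G) (hG2 : MemLp G 2) (hsupp : ∀ ζ ∉ Metric.ball (0 : ℂ) ρ, G ζ = 0)
    (hFG : ∀ z ∈ Ω, dbar F z = G z) (hw : ‖w₀‖ ≤ ρ) (hε : 0 < ε)
    (hwΩ : ∀ z ∈ Ω, ε ≤ ‖z - w₀‖) :
    (fun z => F z - (cauchyTransform G z - (Real.pi : ℂ)⁻¹ * (∫ ζ, G ζ) / (z - w₀)))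
      ∈ bergman 2 Ω := by
  have hGi : Integrable G := by
    have h1 : MemLp G 2 (volume.restrict (Metric.ball 0 ρ)) := hG2.restrict _
    have h2 : IntegrableOn G (Metric.ball 0 ρ) := by
      have : IsFiniteMeasure (volume.restrict (Metric.ball (0 : ℂ) ρ)) :=
        ⟨by rw [Measure.restrict_apply_univ]; exact measure_ball_lt_top⟩
      exact h1.integrable (by norm_num)
    exact h2.integrable_of_forall_notMem_eq_zero hsupp
  set c := (Real.pi : ℂ)⁻¹ * ∫ ζ, G ζ with hc
  have hwΩ' : ∀ z ∈ Ω, z - w₀ ≠ 0 := fun z hz => norm_pos_iff.1 (hε.trans_le (hwΩ z hz))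
  have hdiff : DifferentiableOn ℂ
      (fun z => F z - (cauchyTransform G z - c / (z - w₀))) Ω := by
    have h1 := differentiableOn_sub_cauchyTransform hΩ hF hGi hFG
    have h2 : DifferentiableOn ℂ (fun z => c / (z - w₀)) Ω := fun z hz =>
      (differentiableWithinAt_const c).fun_div (by fun_prop) (hwΩ' z hz)
    exact (h1.add h2).congr fun z _ => by simp only [Pi.add_apply]; ring
  refine (mem_bergman_two_iff hΩ).2 ⟨hdiff, ?_⟩
  have hms := hdiff.continuousOn.aestronglyMeasurable (μ := volume) hΩ.measurableSet
  refine MemLp.restrict_of_inter_of_diff (B := Metric.ball 0 (2 * ρ))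
    Metric.isOpen_ball.measurableSet hms ?_ ?_
  · have hpole : MemLp (fun z => c / (z - w₀)) 2
        (volume.restrict (Ω ∩ Metric.ball 0 (2 * ρ))) := by
      have : IsFiniteMeasure (volume.restrict (Ω ∩ Metric.ball (0 : ℂ) (2 * ρ))) :=
        ⟨by
          rw [Measure.restrict_apply_univ]
          exact (measure_mono Set.inter_subset_right).trans_lt measure_ball_lt_top⟩
      have hm : Measurable fun z => c / (z - w₀) := by fun_prop
      refine MemLp.of_bound hm.aestronglyMeasurable (‖c‖ / ε) ?_
      filter_upwards [ae_restrict_mem (hΩ.inter Metric.isOpen_ball).measurableSet] with z hz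
      rw [norm_div]
      have := hwΩ z hz.1
      gcongr
    exact (hF2.mono_measure (Measure.restrict_mono_set _ Set.inter_subset_left)).sub
      (((memLp_cauchyTransform_ball hG hG2 hsupp _).mono_measure
        (Measure.restrict_mono_set _ Set.inter_subset_right)).sub hpole)
  · have hsub : Ω \ Metric.ball 0 (2 * ρ) ⊆ (Metric.ball (0 : ℂ) (2 * ρ))ᶜ := fun z hz => hz.2
    refine (((memLp_two_inv_sq_norm_compl_ball (R := 2 * ρ) (by linarith)).mono_measure
      (Measure.restrict_mono_set _ hsub)).const_mul
        (Real.pi⁻¹ * (8 * ρ * ∫ ζ, ‖G ζ‖))).mono'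
      (hms.mono_measure (Measure.restrict_mono_set _ Set.sdiff_subset)) ?_
    filter_upwards [ae_restrict_mem
      (hΩ.measurableSet.diff Metric.isOpen_ball.measurableSet)] with z hz
    have hzn : 2 * ρ ≤ ‖z‖ := by simpa using hz.2
    have hF0 : F z = 0 := hFsupp z (by rw [mem_ball_zero_iff]; linarith)
    rw [hF0, zero_sub, norm_neg]
    exact norm_cauchyTransform_sub_le hGi (by linarith) hsupp hw hzn

/-! ### The sectors and the square -/

theorem isOpen_sector : IsOpen sector := by
  have h : sector = Complex.slitPlane ∩ Complex.arg ⁻¹' Set.Ioo (-(Real.pi / 4)) (Real.pi / 4) := by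
    ext z
    simp only [sector, Set.mem_ofPred_eq, Set.mem_inter_iff, Complex.mem_slitPlane_iff_arg,
      Set.mem_preimage, Set.mem_Ioo, abs_lt]
    refine ⟨fun h => ⟨⟨fun h' => ?_, h.1⟩, h.2⟩, fun h => ⟨h.1.2, h.2⟩⟩
    linarith [h.2.2, Real.pi_pos]
  rw [h]
  exact ContinuousOn.isOpen_inter_preimage
    (fun z hz => (Complex.continuousAt_arg hz).continuousWithinAt)
    Complex.isOpen_slitPlane isOpen_Ioo

theorem isOpen_reflectedSector : IsOpen reflectedSector :=
  isOpen_sector.preimage (by fun_prop : Continuous fun z : ℂ => (Real.pi : ℂ) - z)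

theorem isOpen_squareD : IsOpen squareD :=
  isOpen_lt (by fun_prop) continuous_const

theorem abs_im_lt_re_of_mem_sector {z : ℂ} (hz : z ∈ sector) : |z.im| < z.re := by
  obtain ⟨h0, harg⟩ := hz
  rw [← Complex.norm_mul_cos_arg z, ← Complex.norm_mul_sin_arg z, abs_mul, abs_norm]
  refine mul_lt_mul_of_pos_left ?_ (norm_pos_iff.2 h0)
  have hpi := Real.pi_pos
  rw [← Real.cos_abs, Real.abs_sin_eq_sin_abs_of_abs_le_pi (by linarith)]
  calc Real.sin |z.arg| < Real.sin (Real.pi / 4) :=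
        Real.sin_lt_sin_of_lt_of_le_pi_div_two (by linarith [abs_nonneg z.arg]) (by linarith) harg
    _ = Real.cos (Real.pi / 4) := by rw [Real.sin_pi_div_four, Real.cos_pi_div_four]
    _ < Real.cos |z.arg| :=
        Real.cos_lt_cos_of_nonneg_of_le_pi (abs_nonneg _) (by linarith) harg

theorem abs_im_lt_of_mem_reflectedSector {z : ℂ} (hz : z ∈ reflectedSector) :
    |z.im| < Real.pi - z.re := by
  simpa using abs_im_lt_re_of_mem_sector hz

theorem squareD_subset_ball : squareD ⊆ Metric.ball (0 : ℂ) 5 := fun z hz => by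
  have hz : |z.re - Real.pi / 2| + |z.im| < Real.pi / 2 := hz
  rw [mem_ball_zero_iff]
  have h1 := Complex.norm_le_abs_re_add_abs_im z
  have h2 := abs_sub_abs_le_abs_sub z.re (Real.pi / 2)
  rw [abs_of_pos (by linarith [Real.pi_pos] : 0 < Real.pi / 2)] at h2
  linarith [Real.pi_lt_four]

theorem vertexTop_re : vertexTop.re = Real.pi / 2 := by simp [vertexTop]

theorem vertexTop_im : vertexTop.im = Real.pi / 2 := by simp [vertexTop]

theorem vertexBottom_re : vertexBottom.re = Real.pi / 2 := by simp [vertexBottom]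

theorem vertexBottom_im : vertexBottom.im = -(Real.pi / 2) := by simp [vertexBottom]

/-- On `D` the distances to the two vertices are controlled by the vertical distances. -/
theorem norm_sub_vertices_le {z : ℂ} (hz : z ∈ squareD) :
    ‖(z - vertexTop) * (z - vertexBottom)‖ ≤ 4 * ((Real.pi / 2) ^ 2 - z.im ^ 2) := by
  have hz : |z.re - Real.pi / 2| + |z.im| < Real.pi / 2 := hz
  have h1 := Complex.norm_le_abs_re_add_abs_im (z - vertexTop)
  have h2 := Complex.norm_le_abs_re_add_abs_im (z - vertexBottom)
  rw [Complex.sub_re, Complex.sub_im, vertexTop_re, vertexTop_im] at h1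
  rw [Complex.sub_re, Complex.sub_im, vertexBottom_re, vertexBottom_im, sub_neg_eq_add] at h2
  have hy := le_abs_self z.im
  have hy' := neg_abs_le z.im
  have hx := abs_nonneg (z.re - Real.pi / 2)
  rw [abs_of_nonpos (by linarith : z.im - Real.pi / 2 ≤ 0)] at h1
  rw [abs_of_nonneg (by linarith : 0 ≤ z.im + Real.pi / 2)] at h2
  rw [norm_mul]
  calc _ ≤ (2 * (Real.pi / 2 - z.im)) * (2 * (Real.pi / 2 + z.im)) := by
        refine mul_le_mul ?_ ?_ (norm_nonneg _) (by linarith) <;> linarith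
    _ = _ := by ring

theorem sub_vertices_ne_zero {z : ℂ} (hz : z ∈ squareD) :
    (z - vertexTop) * (z - vertexBottom) ≠ 0 := by
  have hz : |z.re - Real.pi / 2| + |z.im| < Real.pi / 2 := hz
  have hx := abs_nonneg (z.re - Real.pi / 2)
  refine mul_ne_zero (sub_ne_zero.2 ?_) (sub_ne_zero.2 ?_) <;> rintro rfl
  · have := le_abs_self vertexTop.im
    rw [vertexTop_im] at this hz
    linarith
  · have := neg_le_abs vertexBottom.im
    rw [vertexBottom_im] at this hz
    linarith

/-! ### The cut-off function -/

/-- The cut-off function on `D`: it equals `1` near the left sides and `0` near the right sides, the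
transition taking place where `|x - π/2| < ((π/2)² - y²) / 4`, a region bounded by two parabolas
through the vertices `π/2 ± iπ/2`. Outside `|y| < π/2` its values play no role. -/
noncomputable def cutoff (z : ℂ) : ℝ :=
  Real.smoothTransition
    ((1 - 4 * ((z.re - Real.pi / 2) * ((Real.pi / 2) ^ 2 - z.im ^ 2)⁻¹)) / 2)

theorem sq_sub_im_sq_pos {z : ℂ} (hz : z ∈ squareD) : 0 < (Real.pi / 2) ^ 2 - z.im ^ 2 := by
  have hz : |z.re - Real.pi / 2| + |z.im| < Real.pi / 2 := hz
  rw [sub_pos, sq_lt_sq, abs_of_pos (by linarith [Real.pi_pos] : 0 < Real.pi / 2)]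
  linarith [abs_nonneg (z.re - Real.pi / 2)]

theorem abs_sub_mul_le_of_mem_squareD {z : ℂ} (hz : z ∈ squareD) :
    |z.re - Real.pi / 2| * (Real.pi / 2 + |z.im|) ≤ (Real.pi / 2) ^ 2 - z.im ^ 2 := by
  have hz : |z.re - Real.pi / 2| + |z.im| < Real.pi / 2 := hz
  rw [← sq_abs z.im, sq_sub_sq, mul_comm]
  refine mul_le_mul_of_nonneg_left (by linarith) ?_
  linarith [abs_nonneg z.im, Real.pi_pos]

theorem contDiffAt_cutoff {z : ℂ} (hz : z ∈ squareD) : ContDiffAt ℝ 1 cutoff z := by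
  have hre : ContDiffAt ℝ 1 (fun w : ℂ => w.re) z := Complex.reCLM.contDiff.contDiffAt
  have him : ContDiffAt ℝ 1 (fun w : ℂ => w.im) z := Complex.imCLM.contDiff.contDiffAt
  refine Real.smoothTransition.contDiff.contDiffAt.comp z ?_
  refine (contDiffAt_const.sub (contDiffAt_const.mul ((hre.sub contDiffAt_const).mul
    ((contDiffAt_const.sub (him.pow 2)).inv ?_)))).div_const 2
  exact (sq_sub_im_sq_pos hz).ne'

/-- The key property of the cut-off: its gradient is `O(1 / (|z - z₀| |z - z₁|))` on `D`. -/
theorem exists_norm_fderiv_cutoff_le : ∃ C, 0 ≤ C ∧ ∀ z ∈ squareD,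
    ‖fderiv ℝ cutoff z‖ ≤ C * ‖(z - vertexTop) * (z - vertexBottom)‖⁻¹ := by
  obtain ⟨M, hM⟩ := isCompact_Icc.exists_bound_of_continuousOn (s := Set.Icc (-1 : ℝ) 2)
    ((Real.smoothTransition.contDiff (n := 1)).continuous_deriv le_rfl).continuousOn
  have hM0 : 0 ≤ M := (norm_nonneg _).trans (hM 0 ⟨by norm_num, by norm_num⟩)
  refine ⟨M * 24, by positivity, fun z hz => ?_⟩
  have hw := sq_sub_im_sq_pos hz
  have hxw := abs_sub_mul_le_of_mem_squareD hz
  have hq := norm_sub_vertices_le hz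
  have hq0 := norm_pos_iff.2 (sub_vertices_ne_zero hz)
  set w := (Real.pi / 2) ^ 2 - z.im ^ 2 with hwdef
  set x := z.re - Real.pi / 2 with hxdef
  have hre : HasFDerivAt (fun w : ℂ => w.re) Complex.reCLM z := Complex.reCLM.hasFDerivAt
  have him : HasFDerivAt (fun w : ℂ => w.im) Complex.imCLM z := Complex.imCLM.hasFDerivAt
  have hden : HasFDerivAt (fun v : ℂ => ((Real.pi / 2) ^ 2 - v.im ^ 2)⁻¹)
      ((2 * z.im / w ^ 2) • Complex.imCLM) z := by
    have h1 : HasDerivAt (fun t : ℝ => ((Real.pi / 2) ^ 2 - t ^ 2)⁻¹) (2 * z.im / w ^ 2) z.im := by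
      refine (((hasDerivAt_pow 2 z.im).const_sub _).fun_inv hw.ne').congr_deriv ?_
      simp [hwdef]
    exact h1.comp_hasFDerivAt z him
  have harg : HasFDerivAt (fun v : ℂ =>
      (1 - 4 * ((v.re - Real.pi / 2) * ((Real.pi / 2) ^ 2 - v.im ^ 2)⁻¹)) / 2)
      ((-2 : ℝ) • (x • ((2 * z.im / w ^ 2) • Complex.imCLM) + w⁻¹ • Complex.reCLM)) z := by
    have h1 := ((hre.sub_const (Real.pi / 2)).mul hden).const_mul (-2)
    refine (h1.const_add (1 / 2)).congr_of_eventuallyEq (Filter.Eventually.of_forall fun v => ?_)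
    simp only [Pi.mul_apply]
    ring
  set t := (1 - 4 * (x * w⁻¹)) / 2 with ht
  have hxt : |x * w⁻¹| ≤ 2 / Real.pi := by
    rw [abs_mul, abs_inv, abs_of_pos hw, ← div_eq_mul_inv, div_le_div_iff₀ hw Real.pi_pos]
    nlinarith [mul_nonneg (abs_nonneg x) (abs_nonneg z.im)]
  have htm : t ∈ Set.Icc (-1 : ℝ) 2 := by
    have h2 : 2 / Real.pi ≤ 3 / 4 := by
      rw [div_le_div_iff₀ Real.pi_pos (by norm_num)]
      linarith [Real.pi_gt_three]
    have := abs_le.1 (hxt.trans h2)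
    exact ⟨by linarith [this.2], by linarith [this.1]⟩
  have hσ : HasDerivAt Real.smoothTransition (deriv Real.smoothTransition t) t :=
    ((Real.smoothTransition.contDiff (n := 1)).differentiable one_ne_zero t).hasDerivAt
  have hfd : HasFDerivAt cutoff _ z := hσ.comp_hasFDerivAt z harg
  rw [hfd.fderiv, norm_smul, mul_assoc]
  refine mul_le_mul (hM t htm) ?_ (norm_nonneg _) hM0
  have hxy : |x| * (2 * |z.im|) ≤ 2 * w := by
    nlinarith [mul_nonneg (abs_nonneg x) Real.pi_pos.le]
  calc ‖(-2 : ℝ) • (x • ((2 * z.im / w ^ 2) • Complex.imCLM) + w⁻¹ • Complex.reCLM)‖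
      ≤ 2 * (|x| * (2 * |z.im| / w ^ 2) + w⁻¹) := by
        rw [norm_smul, Real.norm_eq_abs, abs_neg, abs_two]
        gcongr
        refine (norm_add_le _ _).trans_eq ?_
        simp only [norm_smul, Complex.imCLM_norm, Complex.reCLM_norm, Real.norm_eq_abs, mul_one,
          abs_div, abs_mul, abs_two, abs_pow, abs_inv, abs_of_pos hw]
    _ ≤ 2 * (2 * w / w ^ 2 + w⁻¹) := by
        rw [← mul_div_assoc]
        gcongr
    _ = 6 * w⁻¹ := by field_simp; ring
    _ ≤ 6 * (4 * ‖(z - vertexTop) * (z - vertexBottom)‖⁻¹) := by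
        gcongr
        rw [← div_eq_mul_inv, inv_le_iff_one_le_mul₀ hw, div_mul_eq_mul_div, one_le_div hq0]
        exact hq
    _ = _ := by ring

theorem cutoff_nonneg (z : ℂ) : 0 ≤ cutoff z := Real.smoothTransition.nonneg _

theorem cutoff_le_one (z : ℂ) : cutoff z ≤ 1 := Real.smoothTransition.le_one _

/-- With `x` in the role of `|Re z - π/2|`: the complement of `D` lies outside the transition region
of the cut-off. This is where the factor `4` in the cut-off has to exceed `π`. -/
theorem sq_sub_im_sq_lt {x y : ℝ} (hx : 0 < x) (h : Real.pi / 2 ≤ x + |y|) :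
    (Real.pi / 2) ^ 2 - y ^ 2 < 4 * x := by
  have hpi := Real.pi_lt_four
  rw [← sq_abs y]
  nlinarith [abs_nonneg y, Real.pi_pos, sq_nonneg (Real.pi / 2 - |y|)]

theorem eventually_cutoff_eq_zero {z : ℂ} (hz : z ∉ squareD) (hs : |z.im| < z.re) :
    ∀ᶠ w in nhds z, w ∈ squareD → cutoff w = 0 := by
  have hz : Real.pi / 2 ≤ |z.re - Real.pi / 2| + |z.im| := not_lt.1 hz
  have hx : 0 < z.re - Real.pi / 2 := by
    by_contra! h
    rw [abs_of_nonpos h] at hz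
    linarith
  rw [abs_of_pos hx] at hz
  have hlt := sq_sub_im_sq_lt hx hz
  have hev : ∀ᶠ w : ℂ in nhds z,
      (Real.pi / 2) ^ 2 - w.im ^ 2 < 4 * (w.re - Real.pi / 2) :=
    (isOpen_lt (by fun_prop : Continuous fun w : ℂ => (Real.pi / 2) ^ 2 - w.im ^ 2)
      (by fun_prop)).mem_nhds hlt
  filter_upwards [hev] with w hw hwD
  refine Real.smoothTransition.zero_of_nonpos ?_
  have hpos := sq_sub_im_sq_pos hwD
  have : 1 ≤ 4 * (w.re - Real.pi / 2) * ((Real.pi / 2) ^ 2 - w.im ^ 2)⁻¹ := by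
    rw [← div_eq_mul_inv, one_le_div hpos]
    exact hw.le
  linarith

theorem eventually_cutoff_eq_one {z : ℂ} (hz : z ∉ squareD) (hs : |z.im| < Real.pi - z.re) :
    ∀ᶠ w in nhds z, w ∈ squareD → cutoff w = 1 := by
  have hz : Real.pi / 2 ≤ |z.re - Real.pi / 2| + |z.im| := not_lt.1 hz
  have hx : z.re - Real.pi / 2 < 0 := by
    by_contra! h
    rw [abs_of_nonneg h] at hz
    linarith
  rw [abs_of_neg hx] at hz
  have hlt := sq_sub_im_sq_lt (neg_pos.2 hx) hz
  have hev : ∀ᶠ w : ℂ in nhds z,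
      (Real.pi / 2) ^ 2 - w.im ^ 2 < 4 * -(w.re - Real.pi / 2) :=
    (isOpen_lt (by fun_prop : Continuous fun w : ℂ => (Real.pi / 2) ^ 2 - w.im ^ 2)
      (by fun_prop)).mem_nhds hlt
  filter_upwards [hev] with w hw hwD
  refine Real.smoothTransition.one_of_one_le ?_
  have hpos := sq_sub_im_sq_pos hwD
  have : 1 ≤ 4 * -(w.re - Real.pi / 2) * ((Real.pi / 2) ^ 2 - w.im ^ 2)⁻¹ := by
    rw [← div_eq_mul_inv, one_le_div hpos]
    exact hw.le
  linarith

/-! ### Decomposition -/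

theorem extension_by_zero {D : Set ℂ} (hD : IsOpen D) {h : ℂ → ℂ} {z : ℂ}
    (hh : ContDiffOn ℝ 1 h D) (hz : z ∈ D ∨ ∀ᶠ w in nhds z, w ∈ D → h w = 0) :
    ContDiffAt ℝ 1 (D.indicator h) z ∧ dbar (D.indicator h) z = D.indicator (dbar h) z := by
  by_cases hzD : z ∈ D
  · have heq : D.indicator h =ᶠ[nhds z] h :=
      Filter.eventuallyEq_of_mem (hD.mem_nhds hzD) fun w hw => Set.indicator_of_mem hw h
    rw [Set.indicator_of_mem hzD]
    exact ⟨(hh.contDiffAt (hD.mem_nhds hzD)).congr_of_eventuallyEq heq, dbar_congr heq⟩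
  · have heq : D.indicator h =ᶠ[nhds z] fun _ => 0 := by
      filter_upwards [hz.resolve_left hzD] with w hw
      rw [Set.indicator_apply_eq_zero]
      exact hw
    rw [Set.indicator_of_notMem hzD]
    exact ⟨contDiffAt_const.congr_of_eventuallyEq heq,
      (dbar_congr heq).trans (dbar_eq_zero (differentiableAt_const _))⟩

theorem memLp_div_of_mem_weightedBergman {D : Set ℂ} (hD : IsOpen D) {f q : ℂ → ℂ}
    (hq : Measurable q) (hf : f ∈ weightedBergman 2 D fun z => ‖q z‖ ^ (-2 : ℤ)) :
    MemLp (fun z => f z / q z) 2 (volume.restrict D) := by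
  have hm : AEStronglyMeasurable f (volume.restrict D) :=
    hf.1.continuousOn.aestronglyMeasurable hD.measurableSet
  refine ⟨(hm.aemeasurable.div hq.aemeasurable).aestronglyMeasurable, ?_⟩
  rw [eLpNorm_lt_top_iff_lintegral_rpow_enorm_lt_top (by simp) (by simp)]
  refine lt_of_eq_of_lt (lintegral_congr fun z => ?_) hf.2
  rw [← ofReal_norm, ENNReal.ofReal_rpow_of_nonneg (norm_nonneg _) (by simp)]
  congr 1
  rw [norm_div, ENNReal.toReal_ofNat, Real.div_rpow (norm_nonneg _) (norm_nonneg _),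
    div_eq_mul_inv]
  simp only [zpow_neg]
  norm_cast

/-- The point `π/2 + iπ`, the pole of the corrections, is at positive distance from the sector. -/
theorem le_norm_sub_of_mem_sector {z : ℂ} (hz : z ∈ sector) :
    Real.pi / 4 ≤ ‖z - (Real.pi / 2 + Real.pi * Complex.I)‖ := by
  have hs := abs_im_lt_re_of_mem_sector hz
  by_contra! h
  have h1 := (Complex.abs_re_le_norm _).trans_lt h
  have h2 := (Complex.abs_im_le_norm _).trans_lt h
  simp [abs_lt] at h1 h2
  linarith [le_abs_self z.im]

theorem le_norm_sub_of_mem_reflectedSector {z : ℂ} (hz : z ∈ reflectedSector) :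
    Real.pi / 4 ≤ ‖z - (Real.pi / 2 + Real.pi * Complex.I)‖ := by
  have hs := abs_im_lt_of_mem_reflectedSector hz
  by_contra! h
  have h1 := (Complex.abs_re_le_norm _).trans_lt h
  have h2 := (Complex.abs_im_le_norm _).trans_lt h
  simp [abs_lt] at h1 h2
  linarith [le_abs_self z.im]

theorem theorem2 :
    ∀ f ∈ weightedBergman 2 squareD
        (fun z => ‖(z - vertexTop) * (z - vertexBottom)‖ ^ (-2 : ℤ)),
      ∃ f₁ ∈ bergman 2 sector, ∃ f₂ ∈ bergman 2 reflectedSector,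
        ∀ z ∈ squareD, f z = f₁ z + f₂ z := by
  intro f hf
  set q : ℂ → ℂ := fun z => (z - vertexTop) * (z - vertexBottom) with hq
  have hD := isOpen_squareD
  have hDm : MeasurableSet squareD := hD.measurableSet
  have hfD : ∀ z ∈ squareD, DifferentiableAt ℂ f z := fun z hz =>
    hf.1.differentiableAt (hD.mem_nhds hz)
  have hfm : AEStronglyMeasurable f (volume.restrict squareD) :=
    hf.1.continuousOn.aestronglyMeasurable hDm
  have hfq : MemLp (fun z => f z / q z) 2 (volume.restrict squareD) :=
    memLp_div_of_mem_weightedBergman hD (by fun_prop) hf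
  have hfL2 : MemLp f 2 (volume.restrict squareD) := by
    refine (hfq.norm.const_mul (4 * (Real.pi / 2) ^ 2)).mono' hfm ?_
    filter_upwards [ae_restrict_mem hDm] with z hz
    have h1 : ‖q z‖ ≤ 4 * (Real.pi / 2) ^ 2 :=
      (norm_sub_vertices_le hz).trans (by linarith [sq_nonneg z.im])
    calc ‖f z‖ = ‖q z‖ * ‖f z / q z‖ := by
          rw [← norm_mul, mul_div_cancel₀ _ (sub_vertices_ne_zero hz)]
      _ ≤ _ := by gcongr
  -- On the square `f = h₁ - h₂`, and `h₁`, `h₂` have the same `∂̄`-derivative.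
  set h₁ : ℂ → ℂ := fun z => (cutoff z : ℂ) * f z with hh₁
  set h₂ : ℂ → ℂ := fun z => (cutoff z : ℂ) * f z - f z with hh₂
  have hfC : ContDiffOn ℝ 1 f squareD := (hf.1.contDiffOn hD).restrict_scalars ℝ
  have hχC : ContDiffOn ℝ 1 (fun z => (cutoff z : ℂ)) squareD := fun z hz =>
    (Complex.ofRealCLM.contDiff.contDiffAt.comp z (contDiffAt_cutoff hz)).contDiffWithinAt
  have hC₁ : ContDiffOn ℝ 1 h₁ squareD := hχC.mul hfC
  have hC₂ : ContDiffOn ℝ 1 h₂ squareD := hC₁.sub hfC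
  set G : ℂ → ℂ := squareD.indicator (dbar h₁) with hG
  have hG₂ : squareD.indicator (dbar h₂) = G := by
    refine Set.indicator_congr fun z hz => ?_
    rw [hh₂, dbar_sub ((hC₁.contDiffAt (hD.mem_nhds hz)).differentiableAt one_ne_zero)
      ((hfD z hz).restrictScalars ℝ), dbar_eq_zero (hfD z hz), sub_zero]
  have hdc : ContinuousOn (dbar h₁) squareD := fun z hz =>
    (continuousAt_dbar (hC₁.contDiffAt (hD.mem_nhds hz))).continuousWithinAt
  have hGm : Measurable G := by
    classical
    rw [hG, ← Set.piecewise_eq_indicator]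
    exact hdc.measurable_piecewise continuousOn_const hDm
  have hG2 : MemLp G 2 := by
    obtain ⟨C, hC, hgrad⟩ := exists_norm_fderiv_cutoff_le
    rw [hG, memLp_indicator_iff_restrict hDm]
    refine (hfq.norm.const_mul C).mono' (hdc.aestronglyMeasurable hDm) ?_
    filter_upwards [ae_restrict_mem hDm] with z hz
    calc ‖dbar h₁ z‖ ≤ ‖fderiv ℝ cutoff z‖ * ‖f z‖ :=
          norm_dbar_ofReal_mul_le ((contDiffAt_cutoff hz).differentiableAt one_ne_zero) (hfD z hz)
      _ ≤ C * ‖q z‖⁻¹ * ‖f z‖ := by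
          gcongr
          exact hgrad z hz
      _ = C * ‖f z / q z‖ := by
          rw [norm_div]
          ring
  have hL₁ : MemLp (squareD.indicator h₁) 2 := by
    rw [memLp_indicator_iff_restrict hDm]
    refine hfL2.mono (hC₁.continuousOn.aestronglyMeasurable hDm)
      (Filter.Eventually.of_forall fun z => ?_)
    rw [hh₁, norm_mul, Complex.norm_real, Real.norm_of_nonneg (cutoff_nonneg z)]
    exact mul_le_of_le_one_left (norm_nonneg _) (cutoff_le_one z)
  have hL₂ : MemLp (squareD.indicator h₂) 2 := by
    have : squareD.indicator h₂ = fun z => squareD.indicator h₁ z - squareD.indicator f z :=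
      Set.indicator_sub squareD h₁ f
    rw [this]
    exact hL₁.sub ((memLp_indicator_iff_restrict hDm).2 hfL2)
  have hout : ∀ g : ℂ → ℂ, ∀ ζ ∉ Metric.ball (0 : ℂ) 5, squareD.indicator g ζ = 0 :=
    fun g ζ hζ => Set.indicator_of_notMem (fun h => hζ (squareD_subset_ball h)) g
  have hloc₁ : ∀ z ∈ sector, z ∈ squareD ∨ ∀ᶠ w in nhds z, w ∈ squareD → h₁ w = 0 := by
    intro z hz
    by_cases hzD : z ∈ squareD
    · exact Or.inl hzD
    · refine Or.inr ((eventually_cutoff_eq_zero hzD (abs_im_lt_re_of_mem_sector hz)).mono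
        fun w hw hwD => ?_)
      simp [hh₁, hw hwD]
  have hloc₂ : ∀ z ∈ reflectedSector,
      z ∈ squareD ∨ ∀ᶠ w in nhds z, w ∈ squareD → h₂ w = 0 := by
    intro z hz
    by_cases hzD : z ∈ squareD
    · exact Or.inl hzD
    · refine Or.inr ((eventually_cutoff_eq_one hzD (abs_im_lt_of_mem_reflectedSector hz)).mono
        fun w hw hwD => ?_)
      simp [hh₂, hw hwD]
  have hw₀ : ‖(Real.pi / 2 + Real.pi * Complex.I : ℂ)‖ ≤ 5 := by
    refine (Complex.norm_le_abs_re_add_abs_im _).trans ?_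
    have h1 : (Real.pi / 2 + Real.pi * Complex.I : ℂ).re = Real.pi / 2 := by simp
    have h2 : (Real.pi / 2 + Real.pi * Complex.I : ℂ).im = Real.pi := by simp
    rw [h1, h2, abs_of_pos Real.pi_pos, abs_of_pos (half_pos Real.pi_pos)]
    linarith [Real.pi_lt_d2]
  have key₁ := sub_cauchyTransform_mem_bergman (ρ := 5) isOpen_sector (by norm_num)
    (fun z hz => (extension_by_zero hD hC₁ (hloc₁ z hz)).1.contDiffWithinAt)
    (hL₁.restrict _) (hout h₁) hGm hG2 (hout _)
    (fun z hz => (extension_by_zero hD hC₁ (hloc₁ z hz)).2) hw₀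
    (by linarith [Real.pi_pos]) (fun z hz => le_norm_sub_of_mem_sector hz)
  have key₂ := sub_cauchyTransform_mem_bergman (ρ := 5) isOpen_reflectedSector (by norm_num)
    (fun z hz => (extension_by_zero hD hC₂ (hloc₂ z hz)).1.contDiffWithinAt)
    (hL₂.restrict _) (hout h₂) hGm hG2 (hout _)
    (fun z hz => ((extension_by_zero hD hC₂ (hloc₂ z hz)).2).trans (congrFun hG₂ z)) hw₀
    (by linarith [Real.pi_pos]) (fun z hz => le_norm_sub_of_mem_reflectedSector hz)
  rw [mem_bergman_two_iff isOpen_reflectedSector] at key₂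
  refine ⟨_, key₁, _,
    (mem_bergman_two_iff isOpen_reflectedSector).2 ⟨key₂.1.neg, key₂.2.neg⟩, fun z hz => ?_⟩
  simp only [Pi.neg_apply, Set.indicator_of_mem hz, hh₁, hh₂]
  ring
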